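/- Let $1\le n<m$ and let $\rho(x)=(2\pi)^{-m/2}e^{-\|x\|^2/2}$ be the standard Gaussian density on $\mathbb{R}^m$. Let $f:\mathbb{R}^m\to\mathbb{R}$ be differentiable with $\int f^2\rho\,dx<\infty$, with continuous partial derivatives satisfying $\int (\partial f/\partial x_i)^2\rho\,dx<\infty$ for all $i$, and Lipschitz continuous with constant $L$. Write $$C=\int \nabla f(x)\,\nabla f(x)^T\rho(x)\,dx=W\Lambda W^T,$$ with $W$ orthogonal and $\Lambda=\operatorname{diag}(\lambda_1,\dots,\lambda_m)$, $\lambda_1\ge\dots\ge\lambda_m\ge 0$. Assume $\lambda_n>\lambda_{n+1}$, and let $W_2\in\mathbb{R}^{m\times(m-n)}$ consist of the last $m-n$ columns of $W$. For $V\in\mathbb{R}^{m\times(m-n)}$ with $V^TV=I$, let $$\mu(x,V)=\int_{\mathbb{R}^{m-n}} f\big((I-VV^T)x+Vz\big)\,\pi(z\mid x)\,dz,\qquad \pi(z\mid x)=\frac{\rho\big((I-VV^T)x+Vz\big)}{\int\rho\big((I-VV^T)x+Vz'\big)\,dz'},$$ be the average of $f$ over the affine subspace $x+\operatorname{span}(V)$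 with respect to the conditional density of $\rho$, and let $$R(V)=\tfrac12\int_{\mathbb{R}^m}\big(f(x)-\mu(x,V)\big)^2\rho(x)\,dx .$$ $R(V)$ depends only on $\operatorname{span}(V)$, so $R$ is a function on the Grassmann manifold $\mathbb{G}(m-n,m)$ of $(m-n)$-dimensional subspaces of $\mathbb{R}^m$. Its gradient $\bar\nabla R(V)$ is the matrix $G\in\mathbb{R}^{m\times(m-n)}$ with $V^TG=0$ such that $R(V')=R(V)+\operatorname{tr}\big(G^T(V'-V)\big)+o(\|V'-V\|_F)$ as $V'\to V$ among matrices with orthonormal columns; equivalently, $G=(I-VV^T)\,\partial R/\partial V$ for any extension of $R$ to $\mathbb{R}^{m\times(m-n)}$ that is differentiable at $V$. Then $\bar\nabla R(W_2)$ exists and $$\big\|\bar\nabla R(W_2)\big\|_F\;\le\;L\left(2\sqrt m+\sqrt{m-n}\right)\left(\lambda_{n+1}+\dots+\lambda_m\right)^{1/2},$$ where $\|\cdot\|_F$ is the Frobenius norm. -/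

import Mathlib

open MeasureTheory Filter Topology Asymptotics
open scoped NNReal Gradient

/- Matrices carry the Frobenius norm `‖G‖ = (∑ i, ∑ j, G i j ^ 2) ^ (1/2)`. -/
attribute [local instance] Matrix.frobeniusNormedAddCommGroup Matrix.frobeniusNormedSpace

namespace RidgeApprox

/-- The standard Gaussian density `(2π)^(-m/2) exp(-‖x‖²/2)` on `ℝ^m`. -/
noncomputable def gaussianDensity (m : ℕ) (x : EuclideanSpace ℝ (Fin m)) : ℝ :=
  (2 * Real.pi) ^ (-(m : ℝ) / 2) * Real.exp (-‖x‖ ^ 2 / 2)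

/-- The point `(I - V Vᵀ) x + V z`. For `V` with orthonormal columns, and `U` an orthonormal basis
of the orthogonal complement of the column span of `V`, it is `U y + V z` with `y = Uᵀ x`. -/
noncomputable def slicePoint {m k : ℕ} (V : Matrix (Fin m) (Fin k) ℝ)
    (x : EuclideanSpace ℝ (Fin m)) (z : EuclideanSpace ℝ (Fin k)) : EuclideanSpace ℝ (Fin m) :=
  Matrix.toEuclideanLin (1 - V * V.transpose) x + Matrix.toEuclideanLin V z

/-- The conditional density `π(z | y) = ρ(U y + V z) / ∫ ρ(U y + V z') dz'` at `y = Uᵀ x`. -/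
noncomputable def condDensity {m k : ℕ} (ρ : EuclideanSpace ℝ (Fin m) → ℝ)
    (V : Matrix (Fin m) (Fin k) ℝ) (x : EuclideanSpace ℝ (Fin m))
    (z : EuclideanSpace ℝ (Fin k)) : ℝ :=
  ρ (slicePoint V x z) / ∫ z' : EuclideanSpace ℝ (Fin k), ρ (slicePoint V x z')

/-- The conditional average `μ(x, V) = ∫ f((I - V Vᵀ) x + V z) π(z | y) dz`. -/
noncomputable def condAverage {m k : ℕ} (ρ f : EuclideanSpace ℝ (Fin m) → ℝ)
    (V : Matrix (Fin m) (Fin k) ℝ) (x : EuclideanSpace ℝ (Fin m)) : ℝ :=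
  ∫ z : EuclideanSpace ℝ (Fin k), f (slicePoint V x z) * condDensity ρ V x z

/-- The residual `R(V) = (1/2) ‖f(x) - μ(x, V)‖²` in `L²(ρ)`. -/
noncomputable def residual {m k : ℕ} (ρ f : EuclideanSpace ℝ (Fin m) → ℝ)
    (V : Matrix (Fin m) (Fin k) ℝ) : ℝ :=
  (1 / 2) * ∫ x : EuclideanSpace ℝ (Fin m), (f x - condAverage ρ f V x) ^ 2 * ρ x

/-- The matrix `C = ∫ ∇f ∇fᵀ ρ dx`. -/
noncomputable def gradCov {m : ℕ} (ρ f : EuclideanSpace ℝ (Fin m) → ℝ) :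
    Matrix (Fin m) (Fin m) ℝ :=
  Matrix.of fun i j => ∫ x : EuclideanSpace ℝ (Fin m), (∇ f x) i * (∇ f x) j * ρ x

/-- The `m × k` matrices with orthonormal columns. -/
def stiefel (m k : ℕ) : Set (Matrix (Fin m) (Fin k) ℝ) :=
  {V | V.transpose * V = 1}

/-- `G` is the gradient at `span V` of a function on the Grassmann manifold of `k`-dimensional
subspaces of `ℝ^m`, given as a function `F` of orthonormal bases (matrices with orthonormal
columns). The function is independent of the choice of basis; the tangent space at `span V` is
`{Δ | Vᵀ Δ = 0}` with metric `⟨G, Δ⟩ = tr (Gᵀ Δ)`; and `G` is the tangent vector that represents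
the (Fréchet) differential: `F V' = F V + ⟨G, V' - V⟩ + o(‖V' - V‖)` as `V' → V` among matrices
with orthonormal columns. Equivalently, `G = (I - V Vᵀ) ∂F/∂V` for every extension of `F` to all
matrices that is differentiable at `V`. -/
structure IsGrassmannGradient {m k : ℕ} (F : Matrix (Fin m) (Fin k) ℝ → ℝ)
    (V G : Matrix (Fin m) (Fin k) ℝ) : Prop where
  mem_stiefel : V ∈ stiefel m k
  basis_indep : ∀ V' ∈ stiefel m k, ∀ Q ∈ Matrix.orthogonalGroup (Fin k) ℝ, F (V' * Q) = F V'
  horizontal : V.transpose * G = 0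
  isLittleO : (fun V' => F V' - F V - (G.transpose * (V' - V)).trace)
    =o[𝓝[stiefel m k] V] fun V' => V' - V

/-- The last `m - n` columns of a matrix with `m` columns: the block `W₂` of `W = [W₁ W₂]`. -/
def lastCols {m : ℕ} (n : ℕ) (W : Matrix (Fin m) (Fin m) ℝ) : Matrix (Fin m) (Fin (m - n)) ℝ :=
  Matrix.of fun i j => W i ⟨n + j, by omega⟩

end RidgeApprox

/-! Write `P = V Vᵀ` and let `x`, `y` be independent standard Gaussian vectors. Given `(I - P) x`,
the point `x + P (y - x)` is an independent copy of `x`, so the residual, half a mean conditional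
variance, equals `(1/4) E (f (x + P (y - x)) - f x)²` (`half_integral_sub_average_sq`). This
expression makes sense for every operator `A` in place of `P`, and it is differentiable in `A` by
differentiation under the integral. By Cauchy–Schwarz its derivative at `P` in a direction `S` of
operator norm at most `c` is bounded by `L c √m` times the root mean square of `f (x + P (y - x)) -
f x` (`hasFDerivAt_resampleEnergy`).

That root mean square is controlled by a Gaussian Poincaré inequality
(`integral_resample_sub_sq_le`): join the two copies by a rotation through the angle `π/2`, which
preserves the joint law. This gives the factor `π/2` times `(E ‖P ∇f‖²)^(1/2)`, and for `V = W₂` the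
expectation is the sum of the trailing eigenvalues (`integral_norm_proj_gradient_sq`).

To first order `V Vᵀ` moves by `S = H Vᵀ + V Hᵀ` when `V` moves by `H`. With `H = G`, the gradient
itself, the derivative equals `‖G‖²` (`IsGrassmannGradient.norm_sq_eq`), while the operator norm of
`S` is at most `‖G‖` (`norm_tangent_euclideanCLM_le`). Dividing by `‖G‖` leaves `(π/2) L √m (λ_{n+1}
+ ⋯ + λ_m)^(1/2)`, which is stronger than the claim. -/

namespace RidgeApprox

open ProbabilityTheory
open scoped RealInnerProductSpace

/-! ### The standard Gaussian measure: density, rotation invariance, second moments. -/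

section Gaussian

theorem gaussianDensity_pos (m : ℕ) (x : EuclideanSpace ℝ (Fin m)) : 0 < gaussianDensity m x := by
  unfold gaussianDensity; positivity

theorem continuous_gaussianDensity (m : ℕ) : Continuous (gaussianDensity m) := by
  unfold gaussianDensity; fun_prop

theorem integral_gaussianDensity (m : ℕ) : ∫ x, gaussianDensity m x = 1 := by
  unfold gaussianDensity
  rw [integral_const_mul]
  have h := GaussianFourier.integral_rexp_neg_mul_sq_norm
    (V := EuclideanSpace ℝ (Fin m)) (b := 1 / 2) (by norm_num)
  have h2 : ∀ x : EuclideanSpace ℝ (Fin m), -‖x‖ ^ 2 / 2 = -(1 / 2) * ‖x‖ ^ 2 := fun x => by ring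
  simp_rw [h2, h]
  rw [show Real.pi / (1 / 2) = 2 * Real.pi by ring, ← Real.rpow_add (by positivity)]
  simp [neg_div]

theorem integrable_gaussianDensity (m : ℕ) : Integrable (gaussianDensity m) := by
  by_contra h
  have := integral_gaussianDensity m
  rw [integral_undef h] at this
  exact zero_ne_one this

/-- Both measures have the characteristic function `exp (-‖t‖²/2)`. This turns integrals against `ρ`
into integrals against a probability measure. -/
theorem stdGaussian_eq_withDensity (m : ℕ) :
    stdGaussian (EuclideanSpace ℝ (Fin m)) =
      volume.withDensity fun x => ENNReal.ofReal (gaussianDensity m x) := by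
  have : IsFiniteMeasure
      (volume.withDensity fun x => ENNReal.ofReal (gaussianDensity m x)) :=
    isFiniteMeasure_withDensity_ofReal (integrable_gaussianDensity m).2
  apply Measure.ext_of_charFun
  ext t
  rw [charFun_stdGaussian, charFun_apply,
    integral_withDensity_eq_integral_toReal_smul
      (continuous_gaussianDensity m).measurable.ennreal_ofReal (by simp)]
  simp_rw [ENNReal.toReal_ofReal (gaussianDensity_pos m _).le]
  have h := GaussianFourier.integral_cexp_neg_mul_sq_norm_add (b := 1 / 2) (by norm_num)
    Complex.I t
  have h2 : ∀ x : EuclideanSpace ℝ (Fin m),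
      gaussianDensity m x • Complex.exp (⟪x, t⟫ * Complex.I) =
      (((2 * Real.pi) ^ (-(m : ℝ) / 2) : ℝ) : ℂ) *
        Complex.exp (-(1 / 2) * ‖x‖ ^ 2 + Complex.I * ⟪t, x⟫) := by
    intro x
    rw [Complex.exp_add, gaussianDensity, real_inner_comm]
    simp only [Complex.real_smul, Complex.ofReal_mul, Complex.ofReal_exp]
    push_cast
    ring_nf
  simp_rw [h2]
  rw [integral_const_mul, h, ← mul_assoc]
  have h3 : (((2 * Real.pi) ^ (-(m : ℝ) / 2) : ℝ) : ℂ) *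
      (Real.pi / (1 / 2) : ℂ) ^
        (Module.finrank ℝ (EuclideanSpace ℝ (Fin m)) / 2 : ℂ) = 1 := by
    have h4 : (Real.pi / (1 / 2) : ℂ) = ((2 * Real.pi : ℝ) : ℂ) := by push_cast; ring
    have h5 : (Module.finrank ℝ (EuclideanSpace ℝ (Fin m)) / 2 : ℂ) = (((m : ℝ) / 2 : ℝ) : ℂ) := by
      simp
    rw [h4, h5, ← Complex.ofReal_cpow (by positivity), ← Complex.ofReal_mul,
      ← Real.rpow_add (by positivity)]
    simp [neg_div]
  rw [h3, one_mul]
  congr 1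
  rw [Complex.I_sq]
  ring

theorem integral_mul_gaussianDensity (m : ℕ) (g : EuclideanSpace ℝ (Fin m) → ℝ) :
    ∫ x, g x * gaussianDensity m x = ∫ x, g x ∂stdGaussian (EuclideanSpace ℝ (Fin m)) := by
  rw [stdGaussian_eq_withDensity, integral_withDensity_eq_integral_toReal_smul
      (continuous_gaussianDensity m).measurable.ennreal_ofReal (by simp)]
  simp_rw [ENNReal.toReal_ofReal (gaussianDensity_pos m _).le, smul_eq_mul, mul_comm]

variable {E : Type*} [NormedAddCommGroup E] [InnerProductSpace ℝ E] [FiniteDimensional ℝ E]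
  [MeasurableSpace E] [BorelSpace E]

/-- The standard Gaussian measure is mapped to the standard Gaussian measure by every linear map
whose adjoint is an isometry. -/
theorem map_stdGaussian_of_adjoint {F : Type*} [NormedAddCommGroup F] [InnerProductSpace ℝ F]
    [FiniteDimensional ℝ F] [MeasurableSpace F] [BorelSpace F] (A : E →L[ℝ] F) (B : F →L[ℝ] E)
    (hAB : ∀ x y, ⟪A x, y⟫ = ⟪x, B y⟫) (hB : ∀ y, ‖B y‖ = ‖y‖) :
    (stdGaussian E).map A = stdGaussian F := by
  have := Measure.isProbabilityMeasure_map (μ := stdGaussian E) A.continuous.aemeasurable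
  apply Measure.ext_of_charFun
  ext t
  rw [charFun_stdGaussian, charFun_apply, integral_map A.continuous.aemeasurable
    (by fun_prop)]
  simp_rw [hAB]
  rw [← charFun_apply, charFun_stdGaussian, hB]

/-- The rotation by the angle `θ` of the pairs `(P x, P y)`, with `x - P x` and `y - P y` fixed. -/
noncomputable def partialRotation (P : E →L[ℝ] E) (θ : ℝ) : E × E →L[ℝ] E × E :=
  ((ContinuousLinearMap.fst ℝ E E - P ∘L ContinuousLinearMap.fst ℝ E E) +
    P ∘L (Real.cos θ • ContinuousLinearMap.fst ℝ E E +
      Real.sin θ • ContinuousLinearMap.snd ℝ E E)).prod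
  ((ContinuousLinearMap.snd ℝ E E - P ∘L ContinuousLinearMap.snd ℝ E E) +
    P ∘L (Real.cos θ • ContinuousLinearMap.snd ℝ E E -
      Real.sin θ • ContinuousLinearMap.fst ℝ E E))

omit [FiniteDimensional ℝ E] [MeasurableSpace E] [BorelSpace E] in
theorem partialRotation_apply (P : E →L[ℝ] E) (θ : ℝ) (p : E × E) :
    partialRotation P θ p =
      ((p.1 - P p.1) + P (Real.cos θ • p.1 + Real.sin θ • p.2),
        (p.2 - P p.2) + P (Real.cos θ • p.2 - Real.sin θ • p.1)) := rfl

/-- The joint characteristic function depends only on `‖u‖² + ‖v‖²`, where `u`, `v` represent the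
two components of a functional. The adjoint rotates `(P u, P v)` and fixes the orthogonal parts, so
it preserves this sum. -/
theorem measurePreserving_partialRotation (P : E →L[ℝ] E) (hP : ∀ x, P (P x) = P x)
    (hsym : ∀ x y, ⟪P x, y⟫ = ⟪x, P y⟫) (θ : ℝ) :
    MeasurePreserving (partialRotation P θ) ((stdGaussian E).prod (stdGaussian E))
      ((stdGaussian E).prod (stdGaussian E)) := by
  refine ⟨(partialRotation P θ).continuous.measurable, ?_⟩
  have := Measure.isProbabilityMeasure_map (μ := (stdGaussian E).prod (stdGaussian E))
    (partialRotation P θ).continuous.aemeasurable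
  refine Measure.ext_of_charFunDual ?_
  ext ℓ
  rw [charFunDual_map, charFunDual_prod, charFunDual_prod]
  simp_rw [charFunDual_stdGaussian, ← Complex.exp_add]
  set u := (InnerProductSpace.toDual ℝ E).symm (ℓ.comp (.inl ℝ E E)) with hu
  set v := (InnerProductSpace.toDual ℝ E).symm (ℓ.comp (.inr ℝ E E)) with hv
  have hu' : ∀ x, ℓ (x, 0) = ⟪u, x⟫ := fun x => by simp [hu]
  have hv' : ∀ x, ℓ (0, x) = ⟪v, x⟫ := fun x => by simp [hv]
  have hl : ∀ x y, ℓ (x, y) = ⟪u, x⟫ + ⟪v, y⟫ := fun x y => by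
    rw [← hu', ← hv', ← map_add]; simp
  have e1 : ℓ.comp (.inl ℝ E E) = InnerProductSpace.toDual ℝ E u := by simp [hu]
  have e2 : ℓ.comp (.inr ℝ E E) = InnerProductSpace.toDual ℝ E v := by simp [hv]
  have e3 : (ℓ.comp (partialRotation P θ)).comp (.inl ℝ E E) = InnerProductSpace.toDual ℝ E
      (u - P u + (Real.cos θ • P u - Real.sin θ • P v)) := by
    ext x
    simp [partialRotation_apply, hl, inner_add_right, inner_sub_right, inner_smul_right, hsym]
    ring
  have e4 : (ℓ.comp (partialRotation P θ)).comp (.inr ℝ E E) = InnerProductSpace.toDual ℝ E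
      (v - P v + (Real.cos θ • P v + Real.sin θ • P u)) := by
    ext x
    simp [partialRotation_apply, hl, inner_add_right, inner_sub_right, inner_smul_right, hsym]
    ring
  rw [e1, e2, e3, e4]
  simp only [LinearIsometryEquiv.norm_map]
  congr 1
  have key : ‖u - P u + (Real.cos θ • P u - Real.sin θ • P v)‖ ^ 2 +
      ‖v - P v + (Real.cos θ • P v + Real.sin θ • P u)‖ ^ 2 = ‖u‖ ^ 2 + ‖v‖ ^ 2 := by
    simp only [← real_inner_self_eq_norm_sq]
    simp only [inner_add_left, inner_add_right, inner_sub_left,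
      inner_sub_right, real_inner_smul_left, real_inner_smul_right, hsym, hP, map_smul]
    have h5 : ⟪v, P u⟫ = ⟪u, P v⟫ := by rw [← hsym, real_inner_comm]
    rw [h5]
    linear_combination (⟪u, P u⟫ + ⟪v, P v⟫) * Real.sin_sq_add_cos_sq θ
  have key' := congrArg (fun r : ℝ => (r : ℂ)) key
  push_cast at key'
  linear_combination (-1 / 2) * key'

theorem integrable_norm_sq_stdGaussian : Integrable (fun x : E => ‖x‖ ^ 2) (stdGaussian E) := by
  have := IsGaussian.memLp_two_id (μ := stdGaussian E)
  simpa using this.integrable_norm_pow (by norm_num)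

theorem integral_inner_sq_stdGaussian (v : E) : ∫ y, ⟪v, y⟫ ^ 2 ∂stdGaussian E = ‖v‖ ^ 2 := by
  have h := variance_dual_stdGaussian (InnerProductSpace.toDual ℝ E v)
  rw [LinearIsometryEquiv.norm_map, variance_of_integral_eq_zero
    (by fun_prop) (integral_strongDual_stdGaussian _)] at h
  simpa using h

theorem integral_norm_sq_stdGaussian :
    ∫ x : E, ‖x‖ ^ 2 ∂stdGaussian E = Module.finrank ℝ E := by
  have h : ∀ x : E, ‖x‖ ^ 2 = ∑ i, ⟪stdOrthonormalBasis ℝ E i, x⟫ ^ 2 := fun x =>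
    ((stdOrthonormalBasis ℝ E).sum_sq_inner_right x).symm
  simp_rw [h]
  rw [integral_finsetSum]
  · simp [integral_inner_sq_stdGaussian]
  · intro i _
    refine (integrable_norm_sq_stdGaussian (E := E)).mono' (by fun_prop) (.of_forall fun x => ?_)
    have := abs_real_inner_le_norm (stdOrthonormalBasis ℝ E i) x
    rw [OrthonormalBasis.norm_eq_one, one_mul] at this
    rw [Real.norm_eq_abs, abs_pow]
    gcongr

end Gaussian

/-! ### The residual as an energy of resampling, and its derivative in the operator. -/

section Functional

variable {E : Type*} [NormedAddCommGroup E] [InnerProductSpace ℝ E] [FiniteDimensional ℝ E]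
  [MeasurableSpace E] [BorelSpace E]

theorem memLp_two_of_lipschitzWith {f : E → ℝ} {L : ℝ≥0} (hL : LipschitzWith L f) :
    MemLp f 2 (stdGaussian E) := by
  have h1 : MemLp (fun x : E => L * ‖x‖ + |f 0|) 2 (stdGaussian E) :=
    ((IsGaussian.memLp_two_id (μ := stdGaussian E)).norm.const_mul _).add (memLp_const _)
  refine h1.of_le hL.continuous.aestronglyMeasurable (.of_forall fun x => ?_)
  have h2 := hL.dist_le_mul x 0
  rw [Real.dist_eq, dist_zero_right] at h2
  have h3 : 0 ≤ (L : ℝ) * ‖x‖ + |f 0| := by positivity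
  rw [Real.norm_eq_abs, Real.norm_of_nonneg h3]
  have := abs_sub_abs_le_abs_sub (f x) (f 0)
  linarith

/-- This is the first coordinate of the partial rotation at the angle `π/2`. -/
theorem measurePreserving_resample {P : E →L[ℝ] E} (hP : ∀ x, P (P x) = P x)
    (hsym : ∀ x y, ⟪P x, y⟫ = ⟪x, P y⟫) :
    MeasurePreserving (fun p : E × E => p.1 - P p.1 + P p.2)
      ((stdGaussian E).prod (stdGaussian E)) (stdGaussian E) := by
  have h := (measurePreserving_fst (μ := stdGaussian E) (ν := stdGaussian E)).comp
    (measurePreserving_partialRotation P hP hsym (Real.pi / 2))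
  convert h using 2 with p
  simp [partialRotation_apply]

/-- Half the mean conditional variance of `f` given `x - P x` is a quarter of the mean square of
the difference of two conditionally independent copies. -/
theorem half_integral_sub_average_sq {f : E → ℝ} {L : ℝ≥0} (hL : LipschitzWith L f)
    {P : E →L[ℝ] E} (hP : ∀ x, P (P x) = P x) (hsym : ∀ x y, ⟪P x, y⟫ = ⟪x, P y⟫) :
    (1 / 2) * ∫ x, (f x - ∫ y, f (x - P x + P y) ∂stdGaussian E) ^ 2 ∂stdGaussian E =
      (1 / 4) * ∫ p, (f (p.1 + P (p.2 - p.1)) - f p.1) ^ 2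
        ∂(stdGaussian E).prod (stdGaussian E) := by
  set γ := stdGaussian E
  set μ : E → ℝ := fun x => ∫ y, f (x - P x + P y) ∂γ with hμ
  set X : E × E → E := fun p => p.1 - P p.1 + P p.2 with hX
  have hf : MemLp f 2 γ := memLp_two_of_lipschitzWith hL
  have hXm : MeasurePreserving X (γ.prod γ) γ := measurePreserving_resample hP hsym
  have hint : ∀ x, Integrable (fun y => f (x - P x + P y)) γ := by
    intro x
    have h1 : LipschitzWith (L * ‖P‖₊) fun y => f (x - P x + P y) := by
      refine hL.comp (LipschitzWith.of_dist_le_mul fun y z => ?_)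
      simpa using P.lipschitz.dist_le_mul y z
    exact (memLp_two_of_lipschitzWith h1).integrable (by norm_num)
  -- The Lipschitz property provides both the continuity and the square integrability of the
  -- average.
  have hμL : LipschitzWith (L * ‖ContinuousLinearMap.id ℝ E - P‖₊) μ := by
    refine LipschitzWith.of_dist_le_mul fun x x' => ?_
    rw [Real.dist_eq, hμ]
    simp only
    rw [← integral_sub (hint x) (hint x')]
    have h : ∀ y, ‖f (x - P x + P y) - f (x' - P x' + P y)‖ ≤
        (L * ‖ContinuousLinearMap.id ℝ E - P‖₊ : ℝ≥0) * dist x x' := ?_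
    · have := norm_integral_le_of_norm_le_const (μ := γ) (.of_forall h)
      rwa [probReal_univ, mul_one] at this
    intro y
    rw [← dist_eq_norm]
    refine (hL.dist_le_mul _ _).trans ?_
    push_cast
    rw [mul_assoc]
    gcongr
    rw [dist_add_right]
    exact (ContinuousLinearMap.id ℝ E - P).lipschitz.dist_le_mul x x'
  have hμm : MemLp μ 2 γ := memLp_two_of_lipschitzWith hμL
  have hf1 : MemLp (fun p : E × E => f p.1) 2 (γ.prod γ) := hf.comp_measurePreserving measurePreserving_fst
  have hμ1 : MemLp (fun p : E × E => μ p.1) 2 (γ.prod γ) :=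
    hμm.comp_measurePreserving measurePreserving_fst
  have hfX : MemLp (fun p : E × E => f (X p)) 2 (γ.prod γ) := hf.comp_measurePreserving hXm
  have hμX : ∀ p, μ (X p) = μ p.1 := by
    intro p
    simp only [hμ, hX]
    congr 1
    ext y
    congr 1
    simp [hP]
  have hmap : ∀ g : E → ℝ, Continuous g → ∫ p, g (X p) ∂γ.prod γ = ∫ x, g x ∂γ := fun g hg => by
    rw [← integral_map hXm.measurable.aemeasurable hg.aestronglyMeasurable, hXm.map_eq]
  have e1 : ∫ p, f p.1 * f (X p) ∂γ.prod γ = ∫ x, f x * μ x ∂γ := by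
    rw [integral_prod (fun p => f p.1 * f (X p)) (hf1.integrable_mul hfX)]
    simp_rw [integral_const_mul]
    rfl
  -- The same integral is evaluated twice: integrating out the second variable gives `E μ²`, while
  -- `μ (X p) = μ p.1` and the invariance of the law under `X` give `E μ f`. Hence `E μ² = E f μ`.
  have e2 : ∫ p, μ p.1 * f (X p) ∂γ.prod γ = ∫ x, μ x ^ 2 ∂γ := by
    rw [integral_prod (fun p => μ p.1 * f (X p)) (hμ1.integrable_mul hfX)]
    simp_rw [integral_const_mul, sq]
    rfl
  have e3 : ∫ p, μ p.1 * f (X p) ∂γ.prod γ = ∫ x, μ x * f x ∂γ := by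
    rw [← hmap (fun x => μ x * f x) (hμL.continuous.mul hL.continuous)]
    simp_rw [hμX]
  have e4 : ∫ p, f (X p) ^ 2 ∂γ.prod γ = ∫ x, f x ^ 2 ∂γ := hmap _ (hL.continuous.pow 2)
  have e5 : ∫ p : E × E, f p.1 ^ 2 ∂γ.prod γ = ∫ x, f x ^ 2 ∂γ := by
    rw [integral_fun_fst (fun x => f x ^ 2)]; simp
  have e6 : ∀ p : E × E, p.1 + P (p.2 - p.1) = X p := fun p => by simp [hX]; abel
  have i1 : ∫ x, (f x - μ x) ^ 2 ∂γ =
      ∫ x, f x ^ 2 ∂γ - 2 * ∫ x, f x * μ x ∂γ + ∫ x, μ x ^ 2 ∂γ := by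
    have : Integrable (fun x => f x * μ x) γ := hf.integrable_mul hμm
    have h2 : Integrable (fun x => f x ^ 2 - 2 * (f x * μ x)) γ :=
      hf.integrable_sq.sub (this.const_mul 2)
    rw [← integral_const_mul, ← integral_sub hf.integrable_sq (this.const_mul 2),
      ← integral_add h2 hμm.integrable_sq]
    congr 1; ext x; ring
  have i2 : ∫ p, (f (X p) - f p.1) ^ 2 ∂γ.prod γ =
      ∫ p, f (X p) ^ 2 ∂γ.prod γ - 2 * ∫ p, f p.1 * f (X p) ∂γ.prod γ +
        ∫ p : E × E, f p.1 ^ 2 ∂γ.prod γ := by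
    have : Integrable (fun p => f p.1 * f (X p)) (γ.prod γ) := hf1.integrable_mul hfX
    have h2 : Integrable (fun p => f (X p) ^ 2 - 2 * (f p.1 * f (X p))) (γ.prod γ) :=
      hfX.integrable_sq.sub (this.const_mul 2)
    rw [← integral_const_mul, ← integral_sub hfX.integrable_sq (this.const_mul 2),
      ← integral_add h2 hf1.integrable_sq]
    congr 1; ext x; ring
  simp_rw [e6]
  rw [i1, i2, e1, e4, e5, ← e2, e3]
  simp_rw [mul_comm (μ _) (f _)]
  ring

theorem memLp_two_sub_prod :
    MemLp (fun p : E × E => p.2 - p.1) 2 ((stdGaussian E).prod (stdGaussian E)) :=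
  (IsGaussian.memLp_two_id.comp_measurePreserving measurePreserving_snd).sub
    (IsGaussian.memLp_two_id.comp_measurePreserving measurePreserving_fst)

theorem integrable_norm_sub_sq_prod :
    Integrable (fun p : E × E => ‖p.2 - p.1‖ ^ 2) ((stdGaussian E).prod (stdGaussian E)) :=
  (memLp_two_sub_prod (E := E)).integrable_norm_pow (by norm_num)

/-- The pointwise bound `‖y - x‖² ≤ 2‖x‖² + 2‖y‖²` avoids the cross term. The exact value has 2 in
place of 4; the loss is affordable. -/
theorem integral_norm_sub_sq_le :
    ∫ p : E × E, ‖p.2 - p.1‖ ^ 2 ∂(stdGaussian E).prod (stdGaussian E) ≤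
      4 * Module.finrank ℝ E := by
  have h1 := integrable_norm_sq_stdGaussian (E := E)
  have i1 : Integrable (fun p : E × E => ‖p.1‖ ^ 2) ((stdGaussian E).prod (stdGaussian E)) :=
    h1.comp_fst _
  have i2 : Integrable (fun p : E × E => ‖p.2‖ ^ 2) ((stdGaussian E).prod (stdGaussian E)) :=
    h1.comp_snd _
  calc _ ≤ ∫ p : E × E, (2 * ‖p.1‖ ^ 2 + 2 * ‖p.2‖ ^ 2)
        ∂(stdGaussian E).prod (stdGaussian E) := by
        refine integral_mono integrable_norm_sub_sq_prod ((i1.const_mul 2).add (i2.const_mul 2))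
          fun p => ?_
        have := norm_sub_le p.2 p.1
        have h2 : ‖p.2 - p.1‖ ^ 2 ≤ (‖p.2‖ + ‖p.1‖) ^ 2 := by gcongr
        simp only
        nlinarith [sq_nonneg (‖p.2‖ - ‖p.1‖)]
    _ = _ := by
        rw [integral_add (i1.const_mul 2) (i2.const_mul 2), integral_const_mul, integral_const_mul,
          integral_fun_fst (fun x : E => ‖x‖ ^ 2), integral_fun_snd (fun x : E => ‖x‖ ^ 2),
          integral_norm_sq_stdGaussian]
        simp
        ring

theorem abs_integral_mul_le_sqrt {α : Type*} [MeasurableSpace α] {μ : Measure α} {g h : α → ℝ}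
    (hg : MemLp g 2 μ) (hh : MemLp h 2 μ) :
    |∫ a, g a * h a ∂μ| ≤ √(∫ a, g a ^ 2 ∂μ) * √(∫ a, h a ^ 2 ∂μ) := by
  have h1 := integral_mul_norm_le_Lp_mul_Lq (μ := μ) (f := g) (g := h)
    (p := 2) (q := 2) ⟨by norm_num, by norm_num, by norm_num⟩ (by simpa using hg) (by simpa using hh)
  rw [← Real.norm_eq_abs]
  refine (norm_integral_le_integral_norm _).trans ?_
  simp_rw [norm_mul]
  refine h1.trans_eq ?_
  simp [Real.sqrt_eq_rpow]

/-- The extension of the residual to all operators in place of the orthogonal projection. -/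
noncomputable def resampleEnergy (f : E → ℝ) (A : E →L[ℝ] E) : ℝ :=
  (1 / 4) * ∫ p, (f (p.1 + A (p.2 - p.1)) - f p.1) ^ 2 ∂(stdGaussian E).prod (stdGaussian E)

/-- Near `a` the derivative of the integrand is dominated by a multiple of `‖y - x‖²`. The parameter
`T` allows operators to be parametrized by matrices with the Frobenius norm, while `c` measures a
direction by its operator norm, which the final constant depends on. -/
theorem hasFDerivAt_resampleEnergy {f : E → ℝ} {L : ℝ≥0} (hL : LipschitzWith L f)
    (hd : Differentiable ℝ f) (hc : Continuous (fderiv ℝ f))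
    {H : Type*} [NormedAddCommGroup H] [NormedSpace ℝ H] (T : H →L[ℝ] E →L[ℝ] E) (a : H) :
    ∃ D : H →L[ℝ] ℝ, HasFDerivAt (fun b => resampleEnergy f (T b)) D a ∧
      ∀ (s : H) (c : ℝ), 0 ≤ c → (∀ v, ‖T s v‖ ≤ c * ‖v‖) →
        |D s| ≤ (L : ℝ) * c * √(Module.finrank ℝ E) *
          √(∫ p, (f (p.1 + T a (p.2 - p.1)) - f p.1) ^ 2
            ∂(stdGaussian E).prod (stdGaussian E)) := by
  set Γ := (stdGaussian E).prod (stdGaussian E)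
  set F : H → E × E → ℝ := fun b p => (f (p.1 + T b (p.2 - p.1)) - f p.1) ^ 2 with hF
  set F' : H → E × E → H →L[ℝ] ℝ := fun b p =>
    (2 * (f (p.1 + T b (p.2 - p.1)) - f p.1)) •
      (fderiv ℝ f (p.1 + T b (p.2 - p.1))).comp (T.flip (p.2 - p.1)) with hF'
  have hdist : ∀ (B : E →L[ℝ] E) (p : E × E),
      |f (p.1 + B (p.2 - p.1)) - f p.1| ≤ L * (‖B‖ * ‖p.2 - p.1‖) := by
    intro B p
    have := hL.dist_le_mul (p.1 + B (p.2 - p.1)) p.1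
    rw [Real.dist_eq, dist_eq_norm, add_sub_cancel_left] at this
    exact this.trans (by gcongr; exact B.le_opNorm _)
  have hcontF : ∀ B : E →L[ℝ] E, Continuous fun p : E × E => f (p.1 + B (p.2 - p.1)) - f p.1 :=
    fun B => by have := hL.continuous; fun_prop
  have hmem : ∀ B : E →L[ℝ] E, MemLp (fun p : E × E => f (p.1 + B (p.2 - p.1)) - f p.1) 2 Γ := by
    intro B
    refine (memLp_two_sub_prod.norm.const_mul (L * ‖B‖)).of_le
      (hcontF B).aestronglyMeasurable (.of_forall fun p => ?_)
    rw [Real.norm_eq_abs, Real.norm_of_nonneg (by positivity), mul_assoc]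
    exact hdist B p
  have hfd : ∀ x, ‖fderiv ℝ f x‖ ≤ L := fun x => norm_fderiv_le_of_lipschitz ℝ hL
  have hcont' : Continuous (F' a) := by
    have := hcontF (T a)
    simp only [hF']
    fun_prop
  have happ : ∀ (b : H) p s, F' b p s = 2 * (f (p.1 + T b (p.2 - p.1)) - f p.1) *
      fderiv ℝ f (p.1 + T b (p.2 - p.1)) (T s (p.2 - p.1)) := fun b p s => by simp [hF']
  have hbound : ∀ b ∈ Metric.ball a 1, ∀ p, ‖F' b p‖ ≤
      2 * (L * (‖T‖ * (‖a‖ + 1))) * (L * ‖T‖) * ‖p.2 - p.1‖ ^ 2 := by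
    intro b hb p
    refine ContinuousLinearMap.opNorm_le_bound _ (by positivity) fun s => ?_
    rw [happ, norm_mul, norm_mul, Real.norm_ofNat, Real.norm_eq_abs]
    have h1 := hdist (T b) p
    have h2 : ‖T b‖ ≤ ‖T‖ * (‖a‖ + 1) := by
      have := norm_le_norm_add_norm_sub a b
      rw [mem_ball_iff_norm'] at hb
      exact (T.le_opNorm b).trans (by gcongr; linarith)
    have h3 : ‖fderiv ℝ f (p.1 + T b (p.2 - p.1)) (T s (p.2 - p.1))‖ ≤
        L * (‖T‖ * ‖s‖ * ‖p.2 - p.1‖) :=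
      ((fderiv ℝ f _).le_opNorm _).trans (by gcongr; exacts [hfd _, T.le_opNorm₂ _ _])
    calc _ ≤ 2 * (L * ((‖T‖ * (‖a‖ + 1)) * ‖p.2 - p.1‖)) * (L * (‖T‖ * ‖s‖ * ‖p.2 - p.1‖)) := by
          gcongr
          exact h1.trans (by gcongr)
      _ = _ := by ring
  have hint' : Integrable (F' a) Γ :=
    (integrable_norm_sub_sq_prod.const_mul _).mono'
      hcont'.aestronglyMeasurable (.of_forall (hbound a (Metric.mem_ball_self one_pos)))
  have hder : HasFDerivAt (fun b => ∫ p, F b p ∂Γ) (∫ p, F' a p ∂Γ) a := by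
    refine hasFDerivAt_integral_of_dominated_of_fderiv_le
      (bound := fun p => 2 * (L * (‖T‖ * (‖a‖ + 1))) * (L * ‖T‖) * ‖p.2 - p.1‖ ^ 2)
      (Metric.ball_mem_nhds a one_pos)
      (.of_forall fun b => ((hcontF (T b)).pow 2).aestronglyMeasurable) (hmem (T a)).integrable_sq
      hcont'.aestronglyMeasurable (.of_forall fun p b hb => hbound b hb p)
      (integrable_norm_sub_sq_prod.const_mul _) (.of_forall fun p b _ => ?_)
    have h1 : HasFDerivAt (fun b : H => p.1 + T b (p.2 - p.1)) (T.flip (p.2 - p.1)) b :=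
      ((T.flip (p.2 - p.1)).hasFDerivAt).const_add _
    have h2 := (((hd (p.1 + T b (p.2 - p.1))).hasFDerivAt.comp b h1).sub_const (f p.1)).pow 2
    refine h2.congr_fderiv ?_
    simp [hF']
  refine ⟨(1 / 4 : ℝ) • ∫ p, F' a p ∂Γ, hder.const_smul (1 / 4 : ℝ), fun s c hc0 hS => ?_⟩
  rw [smul_apply, ContinuousLinearMap.integral_apply hint']
  simp_rw [happ, mul_assoc]
  rw [integral_const_mul]
  have hG : MemLp (fun p : E × E => fderiv ℝ f (p.1 + T a (p.2 - p.1)) (T s (p.2 - p.1))) 2 Γ := by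
    refine (memLp_two_sub_prod.norm.const_mul (L * c)).of_le ?_ (.of_forall fun p => ?_)
    · exact Continuous.aestronglyMeasurable (by fun_prop)
    · rw [Real.norm_of_nonneg (by positivity : 0 ≤ (L * c) * ‖p.2 - p.1‖), mul_assoc]
      exact ((fderiv ℝ f _).le_opNorm _).trans (by gcongr; exacts [hfd _, hS _])
  have hCS := abs_integral_mul_le_sqrt (hmem (T a)) hG
  -- The 2 is the root of the 4 in the second moment bound; with the 2 from differentiating the
  -- square it cancels the prefactor `1/4`.
  have hG2 : √(∫ p, (fderiv ℝ f (p.1 + T a (p.2 - p.1)) (T s (p.2 - p.1))) ^ 2 ∂Γ) ≤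
      L * c * (2 * √(Module.finrank ℝ E)) := by
    apply Real.sqrt_le_iff.2 ⟨by positivity, ?_⟩
    calc _ ≤ ∫ p : E × E, (L * c) ^ 2 * ‖p.2 - p.1‖ ^ 2 ∂Γ := by
          refine integral_mono hG.integrable_sq (integrable_norm_sub_sq_prod.const_mul _)
            fun p => ?_
          simp only
          rw [← mul_pow, sq_le_sq, abs_of_nonneg (by positivity : 0 ≤ (L * c) * ‖p.2 - p.1‖),
            mul_assoc]
          exact ((fderiv ℝ f _).le_opNorm _).trans (by gcongr; exacts [hfd _, hS _])
      _ ≤ (L * c) ^ 2 * (4 * Module.finrank ℝ E) := by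
          rw [integral_const_mul]
          gcongr
          exact integral_norm_sub_sq_le
      _ = _ := by
          rw [mul_pow (L * c), mul_pow 2, Real.sq_sqrt (by positivity)]
          ring
  rw [smul_eq_mul, abs_mul, abs_mul, abs_of_pos (by norm_num : (0 : ℝ) < 1 / 4),
    abs_of_pos (by norm_num : (0 : ℝ) < 2)]
  have h5 := hCS.trans (mul_le_mul_of_nonneg_left hG2 (Real.sqrt_nonneg _))
  calc _ ≤ _ := mul_le_mul_of_nonneg_left (mul_le_mul_of_nonneg_left h5 zero_le_two) (by norm_num)
    _ = _ := by ring

end Functional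

/-! ### A Gaussian Poincaré inequality by rotation. -/

section Poincare

variable {E : Type*} [NormedAddCommGroup E] [InnerProductSpace ℝ E] [FiniteDimensional ℝ E]
  [MeasurableSpace E] [BorelSpace E]

/-- Cauchy–Schwarz against a constant, obtained by expanding `0 ≤ ∫ (b g - I)²`. -/
theorem sq_intervalIntegral_le {g : ℝ → ℝ} (hg : Continuous g) {b : ℝ} (hb : 0 < b) :
    (∫ t in (0)..b, g t) ^ 2 ≤ b * ∫ t in (0)..b, g t ^ 2 := by
  set I := ∫ t in (0)..b, g t
  have h0 : 0 ≤ ∫ t in (0)..b, (b * g t - I) ^ 2 :=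
    intervalIntegral.integral_nonneg hb.le fun t _ => sq_nonneg _
  have h1 : ∫ t in (0)..b, (b * g t - I) ^ 2 =
      b ^ 2 * (∫ t in (0)..b, g t ^ 2) - 2 * b * I * I + b * I ^ 2 := by
    have e : ∀ t, (b * g t - I) ^ 2 = b ^ 2 * g t ^ 2 - 2 * b * I * g t + I ^ 2 := fun t => by ring
    have i1 : IntervalIntegrable (fun t => b ^ 2 * g t ^ 2) volume 0 b :=
      Continuous.intervalIntegrable (by fun_prop) _ _
    have i2 : IntervalIntegrable (fun t => 2 * b * I * g t) volume 0 b :=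
      Continuous.intervalIntegrable (by fun_prop) _ _
    have i3 : IntervalIntegrable (fun t => b ^ 2 * g t ^ 2 - 2 * b * I * g t) volume 0 b :=
      Continuous.intervalIntegrable (by fun_prop) _ _
    simp_rw [e]
    rw [intervalIntegral.integral_add i3 intervalIntegrable_const,
      intervalIntegral.integral_sub i1 i2, intervalIntegral.integral_const_mul,
      intervalIntegral.integral_const_mul, intervalIntegral.integral_const, sub_zero, smul_eq_mul]
  rw [h1] at h0
  have h2 : 0 ≤ b * (b * (∫ t in (0)..b, g t ^ 2) - I ^ 2) := by linarith
  have := nonneg_of_mul_nonneg_right h2 hb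
  linarith

/-- A Poincaré inequality for the Gaussian measure, in the form of a bound for the mean square of
the difference of two copies that are conditionally independent given `x - P x`. -/
theorem integral_resample_sub_sq_le {f : E → ℝ} {L : ℝ≥0} (hL : LipschitzWith L f)
    (hd : Differentiable ℝ f) (hc : Continuous (fderiv ℝ f))
    {P : E →L[ℝ] E} (hP : ∀ x, P (P x) = P x) (hsym : ∀ x y, ⟪P x, y⟫ = ⟪x, P y⟫) :
    ∫ p, (f (p.1 + P (p.2 - p.1)) - f p.1) ^ 2 ∂(stdGaussian E).prod (stdGaussian E) ≤
      (Real.pi / 2) ^ 2 * ∫ x, ‖P (∇ f x)‖ ^ 2 ∂stdGaussian E := by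
  set γ := stdGaussian E
  set Γ := γ.prod γ
  set b : ℝ := Real.pi / 2
  have hb : 0 < b := by positivity
  set k : E × E → ℝ := fun p => fderiv ℝ f p.1 (P p.2) with hk
  have hkc : Continuous k := by simp only [hk]; fun_prop
  have hrot : Continuous fun q : (E × E) × ℝ => partialRotation P q.2 q.1 := by
    simp only [partialRotation_apply]
    fun_prop
  have hrotp : ∀ p, Continuous fun t => partialRotation P t p := fun p =>
    hrot.comp (g := fun q : (E × E) × ℝ => partialRotation P q.2 q.1) (f := fun t => (p, t)) (by fun_prop)
  have hfd : ∀ x, ‖fderiv ℝ f x‖ ≤ L := fun x => norm_fderiv_le_of_lipschitz ℝ hL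
  have hkb : ∀ p, |k p| ≤ L * ‖P‖ * ‖p.2‖ := fun p => by
    rw [mul_assoc]
    exact ((fderiv ℝ f _).le_opNorm _).trans (by gcongr; exacts [hfd _, P.le_opNorm _])
  -- The first coordinate of the rotated pair runs from `x` to `x + P (y - x)`, and its velocity is
  -- `P` of the second coordinate. The integrand is therefore one fixed function `k` of the rotated
  -- pair.
  have hpath : ∀ p : E × E, f (p.1 + P (p.2 - p.1)) - f p.1 =
      ∫ t in (0)..b, k (partialRotation P t p) := by
    intro p
    have hder : ∀ t ∈ Set.uIcc 0 b, HasDerivAt (fun t => f (partialRotation P t p).1)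
        (k (partialRotation P t p)) t := by
      intro t _
      have h1 : HasDerivAt (fun t : ℝ => Real.cos t • p.1 + Real.sin t • p.2)
          (-Real.sin t • p.1 + Real.cos t • p.2) t :=
        ((Real.hasDerivAt_cos t).smul_const p.1).add ((Real.hasDerivAt_sin t).smul_const p.2)
      have h2 := (P.hasFDerivAt.comp_hasDerivAt t h1).const_add (p.1 - P p.1)
      have h3 := (hd _).hasFDerivAt.comp_hasDerivAt t h2
      have e : P (partialRotation P t p).2 = P (-Real.sin t • p.1 + Real.cos t • p.2) := by
        simp only [partialRotation_apply, map_add, map_sub, map_smul, hP]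
        module
      refine h3.congr_deriv ?_
      simp only [hk]
      rw [e]
      rfl
    rw [intervalIntegral.integral_eq_sub_of_hasDerivAt hder
      (Continuous.intervalIntegrable (hkc.comp (hrotp p)) _ _)]
    simp only [partialRotation_apply, b]
    congr 2 <;> simp
    abel
  have hsq : ∀ p : E × E, (f (p.1 + P (p.2 - p.1)) - f p.1) ^ 2 ≤
      b * ∫ t in (0)..b, k (partialRotation P t p) ^ 2 := fun p => by
    rw [hpath]
    exact sq_intervalIntegral_le (hkc.comp (hrotp p)) hb
  have hn2 := integrable_norm_sq_stdGaussian (E := E)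
  have i2 : Integrable (fun p : E × E => ‖p.2‖ ^ 2) Γ := hn2.comp_snd _
  have hk2 : Integrable (fun p => k p ^ 2) Γ := by
    refine (i2.const_mul ((L * ‖P‖) ^ 2)).mono' (hkc.pow 2).aestronglyMeasurable
      (.of_forall fun p => ?_)
    rw [Real.norm_eq_abs, abs_pow, ← mul_pow]
    exact pow_le_pow_left₀ (abs_nonneg _) (hkb p) 2
  -- Rotation invariance makes every time of the path contribute equally, so the time integral only
  -- yields a second factor `b`.
  have hΓk : ∀ t, ∫ p, k (partialRotation P t p) ^ 2 ∂Γ = ∫ p, k p ^ 2 ∂Γ := fun t => by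
    have hm := measurePreserving_partialRotation P hP hsym t
    rw [← integral_map hm.measurable.aemeasurable
      (f := fun p => k p ^ 2) (Continuous.aestronglyMeasurable (by fun_prop)), hm.map_eq]
  have hint : Integrable (fun q : (E × E) × ℝ => k (partialRotation P q.2 q.1) ^ 2)
      (Γ.prod (volume.restrict (Set.Ioc 0 b))) := by
    rw [integrable_prod_iff' (Continuous.aestronglyMeasurable (by fun_prop))]
    have h : ∀ t, Integrable (fun p => k (partialRotation P t p) ^ 2) Γ := fun t =>
      (measurePreserving_partialRotation P hP hsym t).integrable_comp_of_integrable hk2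
    refine ⟨.of_forall h, ?_⟩
    simp_rw [Real.norm_of_nonneg (sq_nonneg _), hΓk]
    exact integrable_const _
  -- For fixed `x`, `k` is the pairing of `P (∇ f x)` with the Gaussian vector `y`, whose variance
  -- is the squared norm.
  have hk3 : ∫ p, k p ^ 2 ∂Γ = ∫ x, ‖P (∇ f x)‖ ^ 2 ∂γ := by
    rw [integral_prod _ hk2]
    congr 1
    ext x
    rw [← integral_inner_sq_stdGaussian]
    congr 1
    ext y
    rw [hsym, gradient, InnerProductSpace.toDual_symm_apply]
  have hswap : ∫ p, (∫ t in (0)..b, k (partialRotation P t p) ^ 2) ∂Γ =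
      b * ∫ x, ‖P (∇ f x)‖ ^ 2 ∂γ := by
    simp_rw [intervalIntegral.integral_of_le hb.le]
    rw [integral_integral_swap hint]
    simp_rw [hΓk, hk3]
    simp [hb.le]
  have hint2 : Integrable (fun p => ∫ t in (0)..b, k (partialRotation P t p) ^ 2) Γ := by
    simp_rw [intervalIntegral.integral_of_le hb.le]
    exact hint.integral_prod_left
  calc _ ≤ ∫ p, b * (∫ t in (0)..b, k (partialRotation P t p) ^ 2) ∂Γ := by
        refine integral_mono_of_nonneg (.of_forall fun p => sq_nonneg _) (hint2.const_mul b)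
          (.of_forall hsq)
    _ = _ := by
        rw [integral_const_mul, hswap]
        ring

end Poincare

/-! ### Matrices as operators, orthogonal projections and their tangent vectors. -/

section Matrices

variable {m k l : ℕ}

/-- The continuous linear map between Euclidean spaces given by a matrix. -/
noncomputable def euclideanCLM (M : Matrix (Fin m) (Fin k) ℝ) :
    EuclideanSpace ℝ (Fin k) →L[ℝ] EuclideanSpace ℝ (Fin m) :=
  LinearMap.toContinuousLinearMap (Matrix.toEuclideanLin M)

theorem euclideanCLM_apply (M : Matrix (Fin m) (Fin k) ℝ) (v : EuclideanSpace ℝ (Fin k)) :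
    euclideanCLM M v = Matrix.toEuclideanLin M v := rfl

theorem euclideanCLM_apply_apply (M : Matrix (Fin m) (Fin k) ℝ) (v : EuclideanSpace ℝ (Fin k))
    (i : Fin m) : euclideanCLM M v i = ∑ j, M i j * v j := rfl

theorem euclideanCLM_mul (A : Matrix (Fin m) (Fin k) ℝ) (B : Matrix (Fin k) (Fin l) ℝ)
    (v : EuclideanSpace ℝ (Fin l)) : euclideanCLM (A * B) v = euclideanCLM A (euclideanCLM B v) := by
  simp [euclideanCLM_apply, Matrix.toLpLin_apply]

theorem euclideanCLM_add (A B : Matrix (Fin m) (Fin k) ℝ) :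
    euclideanCLM (A + B) = euclideanCLM A + euclideanCLM B := by
  simp [euclideanCLM]

theorem euclideanCLM_sub (A B : Matrix (Fin m) (Fin k) ℝ) :
    euclideanCLM (A - B) = euclideanCLM A - euclideanCLM B := by
  simp [euclideanCLM]

theorem euclideanCLM_smul (c : ℝ) (A : Matrix (Fin m) (Fin k) ℝ) :
    euclideanCLM (c • A) = c • euclideanCLM A := by
  simp [euclideanCLM]

theorem euclideanCLM_one (v : EuclideanSpace ℝ (Fin m)) :
    euclideanCLM (1 : Matrix (Fin m) (Fin m) ℝ) v = v := by
  simp [euclideanCLM_apply]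

theorem euclideanCLM_zero (v : EuclideanSpace ℝ (Fin k)) :
    euclideanCLM (0 : Matrix (Fin m) (Fin k) ℝ) v = 0 := by
  simp [euclideanCLM_apply]

theorem inner_euclideanCLM_left (A : Matrix (Fin m) (Fin k) ℝ) (x : EuclideanSpace ℝ (Fin k))
    (y : EuclideanSpace ℝ (Fin m)) : ⟪euclideanCLM A x, y⟫ = ⟪x, euclideanCLM A.transpose y⟫ := by
  have h := Matrix.toEuclideanLin_conjTranspose_eq_adjoint A
  rw [Matrix.conjTranspose_eq_transpose_of_trivial] at h
  rw [euclideanCLM_apply, euclideanCLM_apply, h, LinearMap.adjoint_inner_right]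

theorem frobenius_norm_sq (A : Matrix (Fin m) (Fin k) ℝ) : ‖A‖ ^ 2 = ∑ i, ∑ j, A i j ^ 2 := by
  rw [Matrix.frobenius_norm_def, ← Real.sqrt_eq_rpow, Real.sq_sqrt (by positivity)]
  simp

theorem frobenius_norm_sq_eq_trace (A : Matrix (Fin m) (Fin k) ℝ) :
    ‖A‖ ^ 2 = (A.transpose * A).trace := by
  rw [frobenius_norm_sq, Finset.sum_comm]
  simp [Matrix.trace, Matrix.mul_apply, sq]

theorem norm_euclideanCLM_le (A : Matrix (Fin m) (Fin k) ℝ) (v : EuclideanSpace ℝ (Fin k)) :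
    ‖euclideanCLM A v‖ ≤ ‖A‖ * ‖v‖ := by
  refine le_of_sq_le_sq ?_ (by positivity)
  rw [mul_pow, frobenius_norm_sq, EuclideanSpace.real_norm_sq_eq, EuclideanSpace.real_norm_sq_eq,
    Finset.sum_mul]
  refine Finset.sum_le_sum fun i _ => ?_
  rw [euclideanCLM_apply_apply]
  exact Finset.sum_mul_sq_le_sq_mul_sq _ _ _

theorem norm_euclideanCLM_of_stiefel {V : Matrix (Fin m) (Fin k) ℝ} (hV : V ∈ stiefel m k)
    (v : EuclideanSpace ℝ (Fin k)) : ‖euclideanCLM V v‖ = ‖v‖ := by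
  have hV' : V.transpose * V = 1 := hV
  rw [← sq_eq_sq₀ (norm_nonneg _) (norm_nonneg _), ← real_inner_self_eq_norm_sq,
    ← real_inner_self_eq_norm_sq, inner_euclideanCLM_left, ← euclideanCLM_mul, hV',
    euclideanCLM_one]

theorem euclideanCLM_proj_idem {V : Matrix (Fin m) (Fin k) ℝ} (hV : V ∈ stiefel m k)
    (x : EuclideanSpace ℝ (Fin m)) :
    euclideanCLM (V * V.transpose) (euclideanCLM (V * V.transpose) x) =
      euclideanCLM (V * V.transpose) x := by
  have hV' : V.transpose * V = 1 := hV
  rw [← euclideanCLM_mul, Matrix.mul_assoc, ← Matrix.mul_assoc V.transpose, hV', Matrix.one_mul]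

theorem inner_euclideanCLM_proj (V : Matrix (Fin m) (Fin k) ℝ) (x y : EuclideanSpace ℝ (Fin m)) :
    ⟪euclideanCLM (V * V.transpose) x, y⟫ = ⟪x, euclideanCLM (V * V.transpose) y⟫ := by
  rw [inner_euclideanCLM_left, Matrix.transpose_mul, Matrix.transpose_transpose]

/-- The two summands have orthogonal ranges and act on the orthogonal parts `V Vᵀ v` and `v - V Vᵀ
v` of `v`. Pythagoras on both sides gives the constant 1, where the triangle inequality would give
2. -/
theorem norm_tangent_euclideanCLM_le {V G : Matrix (Fin m) (Fin k) ℝ} (hV : V ∈ stiefel m k)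
    (hG : V.transpose * G = 0) (v : EuclideanSpace ℝ (Fin m)) :
    ‖euclideanCLM (G * V.transpose + V * G.transpose) v‖ ≤ ‖G‖ * ‖v‖ := by
  have hG' : G.transpose * V = 0 := by
    rw [← Matrix.transpose_transpose V, ← Matrix.transpose_mul, hG, Matrix.transpose_zero]
  set w := euclideanCLM V.transpose v with hw
  set u := euclideanCLM G.transpose v with hu
  have e1 : euclideanCLM (G * V.transpose + V * G.transpose) v =
      euclideanCLM G w + euclideanCLM V u := by
    rw [euclideanCLM_add, _root_.add_apply, euclideanCLM_mul, euclideanCLM_mul]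
  have e2 : ⟪euclideanCLM G w, euclideanCLM V u⟫ = 0 := by
    rw [inner_euclideanCLM_left, ← euclideanCLM_mul, hG', euclideanCLM_zero, inner_zero_right]
  have e3 : u = euclideanCLM G.transpose (v - euclideanCLM V w) := by
    rw [map_sub, ← euclideanCLM_mul G.transpose, hG', euclideanCLM_zero, sub_zero]
  have e4 : ‖v - euclideanCLM V w‖ ^ 2 = ‖v‖ ^ 2 - ‖w‖ ^ 2 := by
    rw [norm_sub_sq_real, norm_euclideanCLM_of_stiefel hV, real_inner_comm,
      inner_euclideanCLM_left, ← hw, real_inner_self_eq_norm_sq]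
    ring
  have h1 := norm_euclideanCLM_le G w
  have h2 : ‖u‖ ≤ ‖G‖ * ‖v - euclideanCLM V w‖ := by
    rw [e3]
    simpa [Matrix.frobenius_norm_transpose] using
      norm_euclideanCLM_le G.transpose (v - euclideanCLM V w)
  refine le_of_sq_le_sq ?_ (by positivity)
  rw [e1, norm_add_sq_real, e2, norm_euclideanCLM_of_stiefel hV]
  have h3 := pow_le_pow_left₀ (norm_nonneg _) h1 2
  have h4 := pow_le_pow_left₀ (norm_nonneg _) h2 2
  rw [mul_pow] at h3 h4 ⊢
  rw [e4] at h4
  linarith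

end Matrices

/-! ### The residual in terms of the projection `V Vᵀ`. -/

section Residual

variable {m k : ℕ}

theorem slicePoint_eq (V : Matrix (Fin m) (Fin k) ℝ) (x : EuclideanSpace ℝ (Fin m))
    (z : EuclideanSpace ℝ (Fin k)) :
    slicePoint V x z = x - euclideanCLM (V * V.transpose) x + euclideanCLM V z := by
  have h : Matrix.toEuclideanLin (1 - V * V.transpose) x =
      x - euclideanCLM (V * V.transpose) x := by
    rw [← euclideanCLM_apply, euclideanCLM_sub, sub_apply, euclideanCLM_one]
  rw [slicePoint, h]
  rfl

/-- By Pythagoras the density along a slice is a positive factor independent of `z` times the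
`k`-dimensional Gaussian density; normalization cancels the factor. -/
theorem condDensity_gaussianDensity {V : Matrix (Fin m) (Fin k) ℝ} (hV : V ∈ stiefel m k)
    (x : EuclideanSpace ℝ (Fin m)) (z : EuclideanSpace ℝ (Fin k)) :
    condDensity (gaussianDensity m) V x z = gaussianDensity k z := by
  have hV' : V.transpose * V = 1 := hV
  have hn : ∀ z, ‖slicePoint V x z‖ ^ 2 =
      ‖x - euclideanCLM (V * V.transpose) x‖ ^ 2 + ‖z‖ ^ 2 := by
    intro z
    have : ⟪x - euclideanCLM (V * V.transpose) x, euclideanCLM V z⟫ = 0 := by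
      rw [real_inner_comm, inner_euclideanCLM_left, map_sub, ← euclideanCLM_mul,
        ← Matrix.mul_assoc, hV', Matrix.one_mul, sub_self, inner_zero_right]
    rw [slicePoint_eq, norm_add_sq_real, this, norm_euclideanCLM_of_stiefel hV]
    ring
  have hfac : ∃ a : ℝ, 0 < a ∧ ∀ z, gaussianDensity m (slicePoint V x z) =
      a * gaussianDensity k z := by
    refine ⟨(2 * Real.pi) ^ (-(m : ℝ) / 2) * ((2 * Real.pi) ^ (-(k : ℝ) / 2))⁻¹ *
      Real.exp (-‖x - euclideanCLM (V * V.transpose) x‖ ^ 2 / 2), by positivity, fun z => ?_⟩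
    have h0 : ((2 * Real.pi) ^ (-(k : ℝ) / 2) : ℝ) ≠ 0 := by positivity
    rw [gaussianDensity, gaussianDensity, hn, neg_add, add_div, Real.exp_add]
    field_simp
  obtain ⟨a, ha, hfac⟩ := hfac
  simp_rw [condDensity, hfac]
  rw [integral_const_mul, integral_gaussianDensity, mul_one, mul_div_cancel_left₀ _ ha.ne']

/-- The slice variable `z` is realized as `Vᵀ y` with `y` Gaussian on the whole space, so that `V z
= V Vᵀ y`. -/
theorem condAverage_gaussianDensity {V : Matrix (Fin m) (Fin k) ℝ} (hV : V ∈ stiefel m k)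
    {f : EuclideanSpace ℝ (Fin m) → ℝ} (hf : Continuous f) (x : EuclideanSpace ℝ (Fin m)) :
    condAverage (gaussianDensity m) f V x =
      ∫ y, f (x - euclideanCLM (V * V.transpose) x + euclideanCLM (V * V.transpose) y)
        ∂stdGaussian (EuclideanSpace ℝ (Fin m)) := by
  simp_rw [condAverage, condDensity_gaussianDensity hV]
  rw [integral_mul_gaussianDensity, ← map_stdGaussian_of_adjoint (euclideanCLM V.transpose)
    (euclideanCLM V) (fun x y => by rw [inner_euclideanCLM_left, Matrix.transpose_transpose])
    (norm_euclideanCLM_of_stiefel hV),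
    integral_map (euclideanCLM V.transpose).continuous.aemeasurable]
  · simp_rw [slicePoint_eq, euclideanCLM_mul]
  · simp_rw [slicePoint_eq]
    exact Continuous.aestronglyMeasurable (by fun_prop)

theorem residual_eq_resampleEnergy {V : Matrix (Fin m) (Fin k) ℝ} (hV : V ∈ stiefel m k)
    {f : EuclideanSpace ℝ (Fin m) → ℝ} {L : ℝ≥0} (hL : LipschitzWith L f) :
    residual (gaussianDensity m) f V = resampleEnergy f (euclideanCLM (V * V.transpose)) := by
  rw [residual, integral_mul_gaussianDensity]
  simp_rw [condAverage_gaussianDensity hV hL.continuous]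
  exact half_integral_sub_average_sq hL (euclideanCLM_proj_idem hV) (inner_euclideanCLM_proj V)

theorem residual_mul_orthogonal {V : Matrix (Fin m) (Fin k) ℝ} (hV : V ∈ stiefel m k)
    {f : EuclideanSpace ℝ (Fin m) → ℝ} {L : ℝ≥0} (hL : LipschitzWith L f)
    {Q : Matrix (Fin k) (Fin k) ℝ} (hQ : Q ∈ Matrix.orthogonalGroup (Fin k) ℝ) :
    residual (gaussianDensity m) f (V * Q) = residual (gaussianDensity m) f V := by
  have hV' : V.transpose * V = 1 := hV
  have hQ1 : Q * Q.transpose = 1 := (Matrix.mem_orthogonalGroup_iff _ _).1 hQ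
  have hQ2 : Q.transpose * Q = 1 := (Matrix.mem_orthogonalGroup_iff' _ _).1 hQ
  have hVQ : V * Q ∈ stiefel m k := by
    change (V * Q).transpose * (V * Q) = 1
    rw [Matrix.transpose_mul, Matrix.mul_assoc, ← Matrix.mul_assoc V.transpose, hV',
      Matrix.one_mul, hQ2]
  rw [residual_eq_resampleEnergy hV hL, residual_eq_resampleEnergy hVQ hL, Matrix.transpose_mul,
    Matrix.mul_assoc, ← Matrix.mul_assoc Q, hQ1, Matrix.one_mul]

end Residual

/-! ### Grassmann gradients from derivatives in the projection. -/

section Gradient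

variable {m k : ℕ}

/-- `euclideanCLM` for square matrices, as a continuous linear map in the matrix. -/
noncomputable def euclideanCLMHom (m : ℕ) : Matrix (Fin m) (Fin m) ℝ →L[ℝ]
    EuclideanSpace ℝ (Fin m) →L[ℝ] EuclideanSpace ℝ (Fin m) :=
  LinearMap.mkContinuous
    { toFun := euclideanCLM
      map_add' := euclideanCLM_add
      map_smul' := euclideanCLM_smul } 1 fun M => by
    rw [one_mul]
    exact ContinuousLinearMap.opNorm_le_bound _ (norm_nonneg _) (norm_euclideanCLM_le M)

theorem tangent_expansion (V V' : Matrix (Fin m) (Fin k) ℝ) :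
    V' * V'.transpose - V * V.transpose = ((V' - V) * V.transpose + V * (V' - V).transpose) +
      (V' - V) * (V' - V).transpose := by
  simp only [Matrix.transpose_sub, Matrix.sub_mul, Matrix.mul_sub]
  abel

theorem isLittleO_sub_of_norm_le_mul_self {E F : Type*} [NormedAddCommGroup E]
    [NormedAddCommGroup F] {a : E} (s : Set E) {g : E → F}
    (hg : ∀ x, ‖g x‖ ≤ ‖x - a‖ * ‖x - a‖) : g =o[𝓝[s] a] fun x => x - a := by
  have hsub : Tendsto (fun x => x - a) (𝓝[s] a) (𝓝 0) := by
    have : Continuous fun x => x - a := by fun_prop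
    exact (this.tendsto' a 0 (sub_self a)).mono_left nhdsWithin_le_nhds
  have h1 : (fun x => ‖x - a‖ * ‖x - a‖) =o[𝓝[s] a] fun x => (1 : ℝ) * ‖x - a‖ := by
    refine IsLittleO.mul_isBigO ?_ (isBigO_refl _ _)
    rw [isLittleO_one_iff]
    simpa using hsub.norm
  refine (IsBigO.of_bound 1 (.of_forall fun x => ?_)).trans_isLittleO
    (h1.trans_isBigO (IsBigO.of_bound 1 (.of_forall fun x => by simp)))
  rw [one_mul, norm_mul, norm_norm]
  exact hg x

/-- Chain rule through `V ↦ V Vᵀ`, with the quadratic term of the projection absorbed in the error.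
The Poincaré inequality is inserted in the bound for the derivative. -/
theorem residual_isLittleO {f : EuclideanSpace ℝ (Fin m) → ℝ} {L : ℝ≥0} (hL : LipschitzWith L f)
    (hd : Differentiable ℝ f) (hc : Continuous (fderiv ℝ f))
    {V : Matrix (Fin m) (Fin k) ℝ} (hV : V ∈ stiefel m k) :
    ∃ D : Matrix (Fin m) (Fin m) ℝ →ₗ[ℝ] ℝ,
      (∃ K : ℝ, ∀ S, |D S| ≤ K * ‖S‖) ∧
      (∀ (S : Matrix (Fin m) (Fin m) ℝ) (c : ℝ), 0 ≤ c → (∀ v, ‖euclideanCLM S v‖ ≤ c * ‖v‖) →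
        |D S| ≤ (L : ℝ) * c * √m * ((Real.pi / 2) *
          √(∫ x, ‖euclideanCLM (V * V.transpose) (∇ f x)‖ ^ 2
            ∂stdGaussian (EuclideanSpace ℝ (Fin m))))) ∧
      (fun V' => residual (gaussianDensity m) f V' - residual (gaussianDensity m) f V -
        D ((V' - V) * V.transpose + V * (V' - V).transpose)) =o[𝓝[stiefel m k] V]
          fun V' => V' - V := by
  obtain ⟨D, hD, hDb⟩ := hasFDerivAt_resampleEnergy hL hd hc (euclideanCLMHom m) (V * V.transpose)
  have hK : ∀ S, |D S| ≤ ‖D‖ * ‖S‖ := fun S => D.le_opNorm S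
  refine ⟨D.toLinearMap, ⟨‖D‖, hK⟩, fun S c hc0 hS => ?_, ?_⟩
  · refine (hDb S c hc0 hS).trans ?_
    rw [finrank_euclideanSpace_fin]
    gcongr
    refine Real.sqrt_le_iff.2 ⟨by positivity, ?_⟩
    rw [mul_pow, Real.sq_sqrt (integral_nonneg fun x => sq_nonneg _)]
    exact integral_resample_sub_sq_le hL hd hc (euclideanCLM_proj_idem hV)
      (inner_euclideanCLM_proj V)
  · have hquad : (fun V' : Matrix (Fin m) (Fin k) ℝ => (V' - V) * (V' - V).transpose)
        =o[𝓝[stiefel m k] V] fun V' => V' - V := by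
      refine isLittleO_sub_of_norm_le_mul_self _ fun V' => (Matrix.frobenius_norm_mul _ _).trans_eq ?_
      rw [Matrix.frobenius_norm_transpose]
    have hlin : (fun V' : Matrix (Fin m) (Fin k) ℝ => (V' - V) * V.transpose +
        V * (V' - V).transpose) =O[𝓝[stiefel m k] V] fun V' => V' - V := by
      refine IsBigO.of_bound (2 * ‖V‖) (.of_forall fun V' => ?_)
      have h1 := Matrix.frobenius_norm_mul (V' - V) V.transpose
      have h2 := Matrix.frobenius_norm_mul V (V' - V).transpose
      rw [Matrix.frobenius_norm_transpose] at h1 h2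
      refine (norm_add_le _ _).trans ?_
      linarith
    have hΨ : Tendsto (fun V' : Matrix (Fin m) (Fin k) ℝ => V' * V'.transpose)
        (𝓝[stiefel m k] V) (𝓝 (V * V.transpose)) := by
      have : Continuous fun V' : Matrix (Fin m) (Fin k) ℝ => V' * V'.transpose := by fun_prop
      exact (this.tendsto V).mono_left nhdsWithin_le_nhds
    have hmain := hD.isLittleO.comp_tendsto hΨ
    have hdiff : (fun V' : Matrix (Fin m) (Fin k) ℝ => V' * V'.transpose - V * V.transpose)
        =O[𝓝[stiefel m k] V] fun V' => V' - V := by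
      simp_rw [tangent_expansion]
      exact hlin.add hquad.isBigO
    have hDquad : (fun V' : Matrix (Fin m) (Fin k) ℝ => D ((V' - V) * (V' - V).transpose))
        =o[𝓝[stiefel m k] V] fun V' => V' - V :=
      (IsBigO.of_bound ‖D‖ (.of_forall fun V' => hK _)).trans_isLittleO hquad
    refine ((hmain.trans_isBigO hdiff).add hDquad).congr' ?_ .rfl
    filter_upwards [self_mem_nhdsWithin] with V' hV'
    rw [residual_eq_resampleEnergy hV hL, residual_eq_resampleEnergy hV' hL]
    simp only [Function.comp_apply]
    rw [tangent_expansion, map_add]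
    simp [euclideanCLMHom]
    ring

/-- A smooth curve of matrices with orthonormal columns with prescribed horizontal velocity. -/
theorem exists_stiefel_curve {V G : Matrix (Fin m) (Fin k) ℝ} (hV : V ∈ stiefel m k)
    (hG : V.transpose * G = 0) :
    ∃ U : ℝ → Matrix (Fin m) (Fin k) ℝ, (∀ t, U t ∈ stiefel m k) ∧ U 0 = V ∧
      HasDerivAt U G 0 := by
  have hV' : V.transpose * V = 1 := hV
  have hG' : G.transpose * V = 0 := by
    rw [← Matrix.transpose_transpose V, ← Matrix.transpose_mul, hG, Matrix.transpose_zero]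
  -- A skew-symmetric generator, whose exponentials are orthogonal; `A V = G` because `Vᵀ V = 1` and
  -- `Gᵀ V = 0`.
  set A := G * V.transpose - V * G.transpose with hA
  have hAt : A.transpose = -A := by
    simp [hA, Matrix.transpose_mul]
  refine ⟨fun t => NormedSpace.exp (t • A) * V, fun t => ?_, by simp, ?_⟩
  · change (NormedSpace.exp (t • A) * V).transpose * (NormedSpace.exp (t • A) * V) = 1
    have h1 : (NormedSpace.exp (t • A)).transpose * NormedSpace.exp (t • A) = 1 := by
      rw [← Matrix.exp_transpose, Matrix.transpose_smul, hAt, smul_neg,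
        ← Matrix.exp_add_of_commute _ _ (Commute.refl (t • A)).neg_left, neg_add_cancel,
        NormedSpace.exp_zero]
    rw [Matrix.transpose_mul, Matrix.mul_assoc, ← Matrix.mul_assoc _ _ V, h1, Matrix.one_mul, hV']
  · have h1 : HasDerivAt (fun t : ℝ => NormedSpace.exp (t • A)) A 0 := by
      let := Matrix.frobeniusNormedRing (m := Fin m) (α := ℝ)
      let := Matrix.frobeniusNormedAlgebra (m := Fin m) (R := ℝ) (α := ℝ)
      have := hasDerivAt_exp_smul_const (𝕂 := ℝ) A (0 : ℝ)
      rw [zero_smul, NormedSpace.exp_zero, one_mul] at this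
      exact this
    have h2 : HasDerivAt (fun t : ℝ => NormedSpace.exp (t • A) * V) (A * V) 0 := by
      let R : Matrix (Fin m) (Fin m) ℝ →L[ℝ] Matrix (Fin m) (Fin k) ℝ :=
        LinearMap.mkContinuous
          { toFun := fun M => M * V
            map_add' := fun M N => Matrix.add_mul M N V
            map_smul' := fun c M => Matrix.smul_mul c M V } ‖V‖ fun M => by
          rw [mul_comm]; exact Matrix.frobenius_norm_mul M V
      exact R.hasFDerivAt.comp_hasDerivAt 0 h1
    refine h2.congr_deriv ?_
    rw [hA, Matrix.sub_mul, Matrix.mul_assoc, hV', Matrix.mul_assoc, hG', Matrix.mul_zero,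
      Matrix.mul_one, sub_zero]

/-- A function on the Stiefel manifold whose differential factors through the tangent vector
`H Vᵀ + V Hᵀ` of the orthogonal projections has a Grassmann gradient. -/
theorem exists_isGrassmannGradient {F : Matrix (Fin m) (Fin k) ℝ → ℝ}
    {V : Matrix (Fin m) (Fin k) ℝ} (hV : V ∈ stiefel m k)
    (hF : ∀ V' ∈ stiefel m k, ∀ Q ∈ Matrix.orthogonalGroup (Fin k) ℝ, F (V' * Q) = F V')
    (D : Matrix (Fin m) (Fin m) ℝ →ₗ[ℝ] ℝ) (hK : ∃ K : ℝ, ∀ S, |D S| ≤ K * ‖S‖)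
    (hD : (fun V' => F V' - F V - D ((V' - V) * V.transpose + V * (V' - V).transpose))
      =o[𝓝[stiefel m k] V] fun V' => V' - V) :
    ∃ G, IsGrassmannGradient F V G := by
  have hV' : V.transpose * V = 1 := hV
  obtain ⟨K, hK⟩ := hK
  -- Composing the differential with the projection `Q` makes its representing matrix horizontal.
  set Q := 1 - V * V.transpose with hQ
  have hQV : Q * V = 0 := by
    rw [hQ, Matrix.sub_mul, Matrix.mul_assoc, hV', Matrix.one_mul, Matrix.mul_one, sub_self]
  let ℓ : Matrix (Fin m) (Fin k) ℝ →ₗ[ℝ] ℝ :=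
    { toFun := fun H => D (Q * H * V.transpose + V * (Q * H).transpose)
      map_add' := fun H H' => by
        rw [← map_add]
        congr 1
        simp only [Matrix.mul_add, Matrix.add_mul, Matrix.transpose_add]
        abel
      map_smul' := fun c H => by
        rw [RingHom.id_apply, ← map_smul]
        congr 1
        simp only [Matrix.mul_smul, Matrix.smul_mul, Matrix.transpose_smul, smul_add] }
  have hℓ : ∀ H, ℓ H = D (Q * H * V.transpose + V * (Q * H).transpose) := fun H => rfl
  let G : Matrix (Fin m) (Fin k) ℝ := Matrix.of fun i j => ℓ (Matrix.single i j 1)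
  have hG : ∀ H, (G.transpose * H).trace = ℓ H := by
    intro H
    have h1 : H = ∑ i, ∑ j, H i j • Matrix.single i j (1 : ℝ) := by
      conv_lhs => rw [Matrix.matrix_eq_sum_single H]
      simp
    conv_rhs => rw [h1]
    simp only [map_sum, map_smul, smul_eq_mul]
    rw [Finset.sum_comm]
    simp [Matrix.trace, Matrix.mul_apply, G, mul_comm]
  refine ⟨G, hV, hF, ?_, ?_⟩
  -- The functional vanishes on the vertical directions `V N`; the choice `N = Vᵀ G` gives `‖Vᵀ G‖²
  -- = 0`.
  · have h1 : ∀ N : Matrix (Fin k) (Fin k) ℝ, (G.transpose * (V * N)).trace = 0 := by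
      intro N
      rw [hG, hℓ, ← Matrix.mul_assoc, hQV]
      simp
    have h2 := h1 (V.transpose * G)
    rw [← Matrix.mul_assoc] at h2
    have h3 : ‖V.transpose * G‖ ^ 2 = 0 := by
      rw [frobenius_norm_sq_eq_trace, Matrix.transpose_mul, Matrix.transpose_transpose, h2]
    simpa using h3
  · have hquad : (fun V' : Matrix (Fin m) (Fin k) ℝ => (V' - V).transpose * (V' - V))
        =o[𝓝[stiefel m k] V] fun V' => V' - V := by
      refine isLittleO_sub_of_norm_le_mul_self _ fun V' => (Matrix.frobenius_norm_mul _ _).trans_eq ?_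
      rw [Matrix.frobenius_norm_transpose]
    have hrem : (fun V' : Matrix (Fin m) (Fin k) ℝ =>
        D (V * ((V' - V).transpose * (V' - V)) * V.transpose))
          =o[𝓝[stiefel m k] V] fun V' => V' - V := by
      refine (IsBigO.of_bound (|K| * (‖V‖ * ‖V‖)) (.of_forall fun V' => ?_)).trans_isLittleO hquad
      set N := (V' - V).transpose * (V' - V)
      have h1 := Matrix.frobenius_norm_mul (V * N) V.transpose
      have h2 := Matrix.frobenius_norm_mul V N
      rw [Matrix.frobenius_norm_transpose] at h1
      calc |D (V * N * V.transpose)| ≤ K * ‖V * N * V.transpose‖ := hK _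
        _ ≤ |K| * (‖V‖ * ‖N‖ * ‖V‖) := by
          gcongr
          · exact le_abs_self K
          · exact h1.trans (by gcongr)
        _ = _ := by ring
    refine (hD.sub hrem).congr' ?_ .rfl
    filter_upwards [self_mem_nhdsWithin] with V' hVm
    have hVm' : V'.transpose * V' = 1 := hVm
    rw [hG, hℓ, sub_sub, ← map_add]
    congr 2
    set H := V' - V with hH
    -- Orthonormality of both `V` and `V'` makes the symmetric part of `Vᵀ H` quadratic in `H`.
    -- Replacing `H` by `Q H` thus changes the tangent vector only by a second-order term.
    have h1 : H.transpose * H = -(V.transpose * H) - H.transpose * V := by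
      simp only [hH, Matrix.transpose_sub, Matrix.sub_mul, Matrix.mul_sub, hV', hVm']
      abel
    rw [h1, hQ]
    simp only [Matrix.sub_mul, Matrix.mul_sub, Matrix.transpose_sub, Matrix.one_mul,
      Matrix.transpose_mul, Matrix.transpose_transpose, Matrix.mul_neg, Matrix.neg_mul,
      Matrix.mul_assoc]
    abel

/-- The squared norm of a Grassmann gradient is the derivative in the direction of the gradient. -/
theorem IsGrassmannGradient.norm_sq_eq {F : Matrix (Fin m) (Fin k) ℝ → ℝ}
    {V G : Matrix (Fin m) (Fin k) ℝ} (hG : IsGrassmannGradient F V G)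
    (D : Matrix (Fin m) (Fin m) ℝ →ₗ[ℝ] ℝ)
    (hD : (fun V' => F V' - F V - D ((V' - V) * V.transpose + V * (V' - V).transpose))
      =o[𝓝[stiefel m k] V] fun V' => V' - V) :
    ‖G‖ ^ 2 = D (G * V.transpose + V * G.transpose) := by
  obtain ⟨U, hU, hU0, hUd⟩ := exists_stiefel_curve hG.mem_stiefel hG.horizontal
  let ℓ : Matrix (Fin m) (Fin k) ℝ →ₗ[ℝ] ℝ :=
    { toFun := fun H => D (H * V.transpose + V * H.transpose) - (G.transpose * H).trace
      map_add' := fun H H' => by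
        simp only [Matrix.mul_add, Matrix.add_mul, Matrix.transpose_add, map_add,
          Matrix.trace_add]
        ring
      map_smul' := fun c H => by
        simp only [Matrix.mul_smul, Matrix.smul_mul, Matrix.transpose_smul, map_add, map_smul,
          Matrix.trace_smul, smul_eq_mul, RingHom.id_apply]
        ring }
  have hℓ : ∀ H, ℓ H = D (H * V.transpose + V * H.transpose) - (G.transpose * H).trace :=
    fun H => rfl
  -- Two linear approximations of the same function differ by `o(‖V' - V‖)` on the Stiefel set.
  -- Following a curve with velocity `G` shows that they agree at `G`.
  have hlittle : (fun V' => ℓ (V' - V)) =o[𝓝[stiefel m k] V] fun V' => V' - V := by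
    refine (hG.isLittleO.sub hD).congr_left fun V' => ?_
    rw [hℓ]
    ring
  have hUt : Tendsto U (𝓝 0) (𝓝[stiefel m k] V) := by
    refine tendsto_nhdsWithin_iff.2 ⟨?_, .of_forall hU⟩
    rw [← hU0]
    exact hUd.continuousAt
  have h1 : HasDerivAt (fun t => ℓ (U t)) (ℓ G) 0 :=
    (LinearMap.toContinuousLinearMap ℓ).hasFDerivAt.comp_hasDerivAt 0 hUd
  have hUO : (fun t => U t - V) =O[𝓝 0] fun t : ℝ => t - 0 := by
    have := hUd.hasFDerivAt.isBigO_sub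
    rwa [hU0] at this
  have h2 : HasDerivAt (fun t => ℓ (U t)) 0 0 := by
    rw [hasDerivAt_iff_isLittleO]
    refine ((hlittle.comp_tendsto hUt).trans_isBigO hUO).congr_left fun t => ?_
    simp [hU0]
  have h3 := h1.unique h2
  rw [hℓ, ← frobenius_norm_sq_eq_trace] at h3
  linarith

end Gradient

/-! ### The trailing eigenvalues as the mean square of the projected gradient. -/

section Spectrum

variable {m : ℕ}

theorem lastCols_mem_stiefel (n : ℕ) {W : Matrix (Fin m) (Fin m) ℝ}
    (hW : W ∈ Matrix.orthogonalGroup (Fin m) ℝ) : lastCols n W ∈ stiefel m (m - n) := by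
  have h := (Matrix.mem_orthogonalGroup_iff' _ _).1 hW
  change (lastCols n W).transpose * lastCols n W = 1
  ext i j
  have h1 := congrFun (congrFun h ⟨n + i, by omega⟩) ⟨n + j, by omega⟩
  rw [Matrix.mul_apply] at h1
  rw [Matrix.mul_apply]
  refine Eq.trans h1 ?_
  simp [Matrix.one_apply, Fin.ext_iff]

theorem continuous_gradient_of_coord {f : EuclideanSpace ℝ (Fin m) → ℝ}
    (h : ∀ i, Continuous fun x => (∇ f x) i) : Continuous (∇ f) :=
  (PiLp.continuous_toLp 2 _).comp (continuous_pi h)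

theorem continuous_fderiv_of_gradient {f : EuclideanSpace ℝ (Fin m) → ℝ}
    (h : Continuous (∇ f)) : Continuous (fderiv ℝ f) := by
  have : fderiv ℝ f = fun x => InnerProductSpace.toDual ℝ _ (∇ f x) := by
    ext x
    simp [gradient]
  rw [this]
  fun_prop

/-- The squared norm is the sum of `(w_jᵀ ∇f)²` over the last columns `w_j` of `W`, whose means are
the diagonal entries `w_jᵀ C w_j` of `Wᵀ C W = Λ`. -/
theorem integral_norm_proj_gradient_sq {f : EuclideanSpace ℝ (Fin m) → ℝ} {L : ℝ≥0}
    (hL : LipschitzWith L f) (hc : Continuous (∇ f)) (n : ℕ) (lam : Fin m → ℝ)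
    {W : Matrix (Fin m) (Fin m) ℝ} (hW : W ∈ Matrix.orthogonalGroup (Fin m) ℝ)
    (hC : gradCov (gaussianDensity m) f = W * Matrix.diagonal lam * W.transpose) :
    ∫ x, ‖euclideanCLM (lastCols n W * (lastCols n W).transpose) (∇ f x)‖ ^ 2
      ∂stdGaussian (EuclideanSpace ℝ (Fin m)) = ∑ j : Fin (m - n), lam ⟨n + j, by omega⟩ := by
  have hWW := (Matrix.mem_orthogonalGroup_iff' _ _).1 hW
  set γ := stdGaussian (EuclideanSpace ℝ (Fin m))
  have hb : ∀ x i, |(∇ f x) i| ≤ L := by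
    intro x i
    refine (PiLp.norm_apply_le (∇ f x) i).trans ?_
    rw [gradient, LinearIsometryEquiv.norm_map]
    exact norm_fderiv_le_of_lipschitz ℝ hL
  have hint : ∀ i j, Integrable (fun x => (∇ f x) i * (∇ f x) j) γ := by
    intro i j
    refine (integrable_const ((L : ℝ) * L)).mono' (Continuous.aestronglyMeasurable (by fun_prop))
      (.of_forall fun x => ?_)
    rw [norm_mul]
    exact mul_le_mul (hb x i) (hb x j) (norm_nonneg _) L.2
  have hCij : ∀ i j, ∫ x, (∇ f x) i * (∇ f x) j ∂γ =
      (W * Matrix.diagonal lam * W.transpose) i j := by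
    intro i j
    rw [← hC, gradCov, Matrix.of_apply, integral_mul_gaussianDensity]
  have hnorm : ∀ x, ‖euclideanCLM (lastCols n W * (lastCols n W).transpose) (∇ f x)‖ ^ 2 =
      ∑ j : Fin (m - n), ∑ a, ∑ b, W a ⟨n + j, by omega⟩ * W b ⟨n + j, by omega⟩ *
        ((∇ f x) a * (∇ f x) b) := by
    intro x
    rw [euclideanCLM_mul, norm_euclideanCLM_of_stiefel (lastCols_mem_stiefel n hW),
      EuclideanSpace.real_norm_sq_eq]
    refine Finset.sum_congr rfl fun j _ => ?_
    rw [euclideanCLM_apply_apply, sq, Finset.sum_mul_sum]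
    refine Finset.sum_congr rfl fun a _ => Finset.sum_congr rfl fun b _ => ?_
    simp only [lastCols, Matrix.transpose_apply, Matrix.of_apply]
    ring
  simp_rw [hnorm]
  rw [integral_finsetSum _ fun j _ => integrable_finsetSum _ fun a _ =>
    integrable_finsetSum _ fun b _ => (hint a b).const_mul _]
  refine Finset.sum_congr rfl fun j _ => ?_
  rw [integral_finsetSum _ fun a _ => integrable_finsetSum _ fun b _ => (hint a b).const_mul _]
  simp_rw [integral_finsetSum _ fun b _ => (hint _ b).const_mul _, integral_const_mul, hCij]
  set p : Fin m := ⟨n + j, by omega⟩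
  have h1 : W.transpose * (W * Matrix.diagonal lam * W.transpose) * W = Matrix.diagonal lam := by
    rw [← Matrix.mul_assoc, ← Matrix.mul_assoc, hWW, Matrix.one_mul, Matrix.mul_assoc, hWW,
      Matrix.mul_one]
  have h2 := congrFun (congrFun h1 p) p
  rw [Matrix.diagonal_apply_eq] at h2
  rw [← h2, Matrix.mul_apply, Finset.sum_comm]
  refine Finset.sum_congr rfl fun b _ => ?_
  rw [Matrix.mul_apply, Finset.sum_mul]
  refine Finset.sum_congr rfl fun a _ => ?_
  rw [Matrix.transpose_apply]
  ring

end Spectrum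

end RidgeApprox

/-! ### Existence of the gradient and the bound. -/

theorem theorem3 (m n : ℕ) (hn : 1 ≤ n) (hnm : n < m)
    (f : EuclideanSpace ℝ (Fin m) → ℝ)
    (hf_sq : Integrable (fun x => f x ^ 2 * RidgeApprox.gaussianDensity m x))
    (hf_cont : Continuous f) (hf_diff : Differentiable ℝ f)
    (hgrad_cont : ∀ i, Continuous fun x => (∇ f x) i)
    (hgrad_sq : ∀ i, Integrable (fun x => (∇ f x) i ^ 2 * RidgeApprox.gaussianDensity m x))
    (L : ℝ≥0) (hL : LipschitzWith L f)
    (lam : Fin m → ℝ) (W : Matrix (Fin m) (Fin m) ℝ)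
    (hlam : Antitone lam) (hW : W ∈ Matrix.orthogonalGroup (Fin m) ℝ)
    (hC : RidgeApprox.gradCov (RidgeApprox.gaussianDensity m) f
      = W * Matrix.diagonal lam * W.transpose)
    (hgap : lam ⟨n, hnm⟩ < lam ⟨n - 1, by omega⟩) :
    (∃ G : Matrix (Fin m) (Fin (m - n)) ℝ,
      RidgeApprox.IsGrassmannGradient
        (RidgeApprox.residual (RidgeApprox.gaussianDensity m) f) (RidgeApprox.lastCols n W) G) ∧
    ∀ G : Matrix (Fin m) (Fin (m - n)) ℝ,
      RidgeApprox.IsGrassmannGradient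
        (RidgeApprox.residual (RidgeApprox.gaussianDensity m) f) (RidgeApprox.lastCols n W) G →
      ‖G‖ ≤ (L : ℝ) * (2 * √(m : ℝ) + √((m : ℝ) - (n : ℝ))) *
        √(∑ j : Fin (m - n), lam ⟨n + j, by omega⟩) := by

  have hcg := RidgeApprox.continuous_gradient_of_coord hgrad_cont
  have hc := RidgeApprox.continuous_fderiv_of_gradient hcg
  have hV := RidgeApprox.lastCols_mem_stiefel n hW
  obtain ⟨D, hK, hb, hD⟩ := RidgeApprox.residual_isLittleO hL hf_diff hc hV
  rw [RidgeApprox.integral_norm_proj_gradient_sq hL hcg n lam hW hC] at hb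
  refine ⟨RidgeApprox.exists_isGrassmannGradient hV
    (fun V' hV' Q hQ => RidgeApprox.residual_mul_orthogonal hV' hL hQ) D hK hD, fun G hG => ?_⟩
  have h1 := hG.norm_sq_eq D hD
  have h2 := hb _ ‖G‖ (norm_nonneg _)
    (RidgeApprox.norm_tangent_euclideanCLM_le hV hG.horizontal)
  rw [← h1, abs_of_nonneg (sq_nonneg _)] at h2
  set ε := √(∑ j : Fin (m - n), lam ⟨n + j, by omega⟩)
  -- The Poincaré constant `π/2` already fits under the coefficient 2 of `√m`; the term `√(m - n)`
  -- is added for free.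
  have hpi : Real.pi / 2 ≤ 2 := by linarith [Real.pi_le_four]
  have h3 : (L : ℝ) * √(m : ℝ) * (Real.pi / 2 * ε) ≤
      (L : ℝ) * (2 * √(m : ℝ) + √((m : ℝ) - (n : ℝ))) * ε := by
    calc (L : ℝ) * √(m : ℝ) * (Real.pi / 2 * ε) ≤ (L : ℝ) * √(m : ℝ) * (2 * ε) := by gcongr
      _ = (L : ℝ) * (2 * √(m : ℝ)) * ε := by ring
      _ ≤ _ := by
        gcongr
        exact le_add_of_nonneg_right (Real.sqrt_nonneg _)
  refine le_trans ?_ h3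
  rcases (norm_nonneg G).eq_or_lt with h0 | h0
  · rw [← h0]; positivity
  · refine le_of_mul_le_mul_left ?_ h0
    calc ‖G‖ * ‖G‖ = ‖G‖ ^ 2 := by ring
      _ ≤ _ := h2
      _ = _ := by ring
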